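/- Let $\mathcal H$ be a separable real or complex Hilbert space. A frame for $\mathcal H$ is a finite or countable family $(x_j)_{j\in J}$ of vectors (repetitions allowed) with dense linear span for which there are constants $0<A\le B$ with $A\|w\|^2\le\sum_j|\langle w,x_j\rangle|^2\le B\|w\|^2$ for all $w\in\mathcal H$; its length is the cardinality of $J$. It is spherical, of radius $r>0$, if $\|x_j\|=r$ for all $j$. Its frame operator is $Sw=\sum_j\langle w,x_j\rangle x_j$, the series converging unconditionally in norm for every $w\in\mathcal H$. The essential norm of a bounded operator $B$ is $\|B\|_{\mathrm{ess}}=\inf\{\|B-K\| : K \text{ a compact operator on } \mathcal H\}$. Let $S$ be a positive invertible bounded operator on $\mathcal H$. Then: 1. $S$ is the frame operator of a spherical frame for $\mathcal H$. 2. If $\mathcal H$ has finite dimension $n\ge 1$, then for every integer $k\ge n$, $S$ is the frame operator of a spherical frame of length $k$ and radius $\sqrt{\operatorname{trace}(S)/k}$; moreover every spherical frame of length $k$ with frame operator $S$ has this radius. 3. If $\mathcal H$ is infinite-dimensional, then for every real $r$ with $0<r<\|S\|_{\mathrm{ess}}^{1/2}$, $S$ is the frame operator of a spherical frame of radius $r$.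 -/

import Mathlib

/-- A family `x` of vectors of a Hilbert space is a frame: it is complete (its linear span is dense)
and there are constants `0 < A ≤ B` with `A ‖w‖² ≤ ∑ |⟨w, x j⟩|² ≤ B ‖w‖²` for all `w`, the sum
being convergent. -/
def IsFrame (𝕜 : Type*) {H ι : Type*} [RCLike 𝕜] [NormedAddCommGroup H] [InnerProductSpace 𝕜 H]
    (x : ι → H) : Prop :=
  (Submodule.span 𝕜 (Set.range x)).topologicalClosure = ⊤ ∧
    ∃ A B : ℝ, 0 < A ∧ A ≤ B ∧ ∀ w : H,
      Summable (fun j => ‖inner 𝕜 (x j) w‖ ^ 2) ∧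
      A * ‖w‖ ^ 2 ≤ ∑' j, ‖inner 𝕜 (x j) w‖ ^ 2 ∧
      ∑' j, ‖inner 𝕜 (x j) w‖ ^ 2 ≤ B * ‖w‖ ^ 2

/-- `x` is a frame contained in the sphere of radius `r > 0` centred at the origin. -/
def IsSphericalFrame (𝕜 : Type*) {H ι : Type*} [RCLike 𝕜] [NormedAddCommGroup H]
    [InnerProductSpace 𝕜 H] (r : ℝ) (x : ι → H) : Prop :=
  0 < r ∧ IsFrame 𝕜 x ∧ ∀ j, x j ∈ Metric.sphere (0 : H) r

/-- `S` is the frame operator of the family `x`: `S w = ∑ j, ⟨w, x j⟩ x j` for all `w`, with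
(unconditional) convergence in norm, i.e. `S = ∑ j, x j ⊗ x j` in the strong operator topology.
Mathlib's inner product is linear in its second argument. -/
def IsFrameOperator {𝕜 H ι : Type*} [RCLike 𝕜] [NormedAddCommGroup H] [InnerProductSpace 𝕜 H]
    (S : H →L[𝕜] H) (x : ι → H) : Prop :=
  ∀ w : H, HasSum (fun j => inner 𝕜 (x j) w • x j) (S w)

/-- The essential norm: the infimum of `‖B - K‖` over all compact operators `K`. -/
noncomputable def essNorm {𝕜 H : Type*} [RCLike 𝕜] [NormedAddCommGroup H] [InnerProductSpace 𝕜 H]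
    (B : H →L[𝕜] H) : ℝ :=
  sInf {c : ℝ | ∃ K : H →L[𝕜] H, IsCompactOperator K ∧ c = ‖B - K‖}

section

open Filter Topology InnerProductSpace

/-! Factor `S = T T†` with `T : E →L[𝕜] H` and `E` isomorphic to `H`. For an orthonormal basis `b`
of `E`, the vectors `T (b i)` satisfy `∑ |⟪T (b i), w⟫|² = ‖T† w‖² = ⟪S w, w⟫`. For `S` positive and
bounded below, this identity alone makes a family a frame with operator `S`
(`isFrameOperator_of_hasSum`, `isFrame_of_hasSum`), so it remains to equalise norms without changing
the quadratic form. Rotating a pair of vectors keeps the form and can give one of them any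
intermediate norm (`exists_rotation`); hence a finite family can be brought to its average square
norm. In finite dimension, pad with zeros to length `k` and average; the trace is the total square
norm.

In infinite dimension, let `t = r² < s < essNorm S`. Some orthonormal sequence has `‖T (f n)‖² ≥ s`;
extend it to a Hilbert basis and arrange the images in finite blocks whose totals exceed `t` times
their length. A total need not be a multiple of `t`, so one vector `v` is split into `√c v` and `√(1
- c) v`, the first being carried to the next block. Each block is then averaged
(`exists_equal_norm_of_blocks`). -/

/-! ### Positive operators and quadratic forms of frames. -/

/-- A positive operator `D` with `re ⟪D u, u⟫ ≤ C ‖u‖²` satisfies `‖D u‖² ≤ C re ⟪D u, u⟫`. -/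
theorem ContinuousLinearMap.IsPositive.norm_sq_apply_le {𝕜 H : Type*} [RCLike 𝕜]
    [NormedAddCommGroup H] [InnerProductSpace 𝕜 H] {D : H →L[𝕜] H} (hD : D.IsPositive) {C : ℝ}
    (hC : ∀ u, RCLike.re (inner 𝕜 (D u) u) ≤ C * ‖u‖ ^ 2) (u : H) :
    ‖D u‖ ^ 2 ≤ C * RCLike.re (inner 𝕜 (D u) u) := by
  have key : ∀ s : ℝ, 0 ≤ RCLike.re (inner 𝕜 (D u) u) - 2 * s * ‖D u‖ ^ 2 +
      s ^ 2 * (C * ‖D u‖ ^ 2) := by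
    intro s
    have h0 := hD.re_inner_nonneg_left (u - (s : 𝕜) • D u)
    have h1 : inner 𝕜 (D (D u)) u = inner 𝕜 (D u) (D u) := hD.inner_left_eq_inner_right _ _
    have h2 := hC (D u)
    rw [map_sub, map_smul, inner_sub_left, inner_sub_right, inner_sub_right, inner_smul_left,
      inner_smul_left, inner_smul_right, inner_smul_right, h1, RCLike.conj_ofReal] at h0
    simp only [map_sub, RCLike.re_ofReal_mul, inner_self_eq_norm_sq] at h0
    nlinarith [mul_le_mul_of_nonneg_left h2 (sq_nonneg s)]
  by_cases h0 : D u = 0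
  · simp [h0]
  have hpos : 0 < ‖D u‖ ^ 2 := by positivity
  have hCpos : 0 < C := by
    have h2 := hC (D u)
    have h3 := hD.re_inner_nonneg_left (D u)
    have hC0 : 0 ≤ C := by
      by_contra! h
      nlinarith
    rcases hC0.eq_or_lt with h | h
    · exfalso
      -- For `C = 0` the polynomial in `s` is affine, and this `s` makes it negative.
      have h4 := key ((RCLike.re (inner 𝕜 (D u) u) + 1) / ‖D u‖ ^ 2)
      have h5 := hD.re_inner_nonneg_left u
      rw [← h] at h4
      rw [mul_assoc, div_mul_cancel₀ _ hpos.ne'] at h4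
      nlinarith
    · exact h
  have h4 := key C⁻¹
  have h5 : C * (RCLike.re (inner 𝕜 (D u) u) - 2 * C⁻¹ * ‖D u‖ ^ 2 +
      C⁻¹ ^ 2 * (C * ‖D u‖ ^ 2)) = C * RCLike.re (inner 𝕜 (D u) u) - ‖D u‖ ^ 2 := by
    field_simp
    ring
  have := mul_nonneg hCpos.le h4
  linarith

theorem ContinuousLinearMap.re_inner_apply_self_le {𝕜 H : Type*} [RCLike 𝕜]
    [NormedAddCommGroup H] [InnerProductSpace 𝕜 H] (S : H →L[𝕜] H) (u : H) :
    RCLike.re (inner 𝕜 (S u) u) ≤ ‖S‖ * ‖u‖ ^ 2 := by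
  calc RCLike.re (inner 𝕜 (S u) u) ≤ ‖S u‖ * ‖u‖ := re_inner_le_norm _ _
    _ ≤ ‖S‖ * ‖u‖ * ‖u‖ := by gcongr; exact S.le_opNorm u
    _ = _ := by ring

/-- A positive invertible operator is bounded below. -/
theorem ContinuousLinearMap.IsPositive.exists_lower_bound {𝕜 H : Type*} [RCLike 𝕜]
    [NormedAddCommGroup H] [InnerProductSpace 𝕜 H] {S : H →L[𝕜] H} (hS : S.IsPositive)
    (hu : IsUnit S) : ∃ c : ℝ, 0 < c ∧ ∀ u, c * ‖u‖ ^ 2 ≤ RCLike.re (inner 𝕜 (S u) u) := by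
  obtain ⟨U, rfl⟩ := hu
  set S : H →L[𝕜] H := ↑U
  set R : H →L[𝕜] H := ↑U⁻¹
  have hRS : ∀ u, R (S u) = u := fun u => congrArg (fun A : H →L[𝕜] H => A u) U.inv_mul
  have hK : 0 < ‖R‖ ^ 2 * ‖S‖ + 1 := by positivity
  -- From `‖u‖² ≤ ‖R‖² ‖S u‖² ≤ ‖R‖² ‖S‖ ⟪S u, u⟫`; the added `1` covers the trivial space.
  refine ⟨(‖R‖ ^ 2 * ‖S‖ + 1)⁻¹, by positivity, fun u => ?_⟩
  have h1 := hS.norm_sq_apply_le S.re_inner_apply_self_le u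
  have h2 : ‖u‖ ≤ ‖R‖ * ‖S u‖ := by simpa [hRS] using R.le_opNorm (S u)
  have h3 : ‖u‖ ^ 2 ≤ (‖R‖ * ‖S u‖) ^ 2 := by gcongr
  have h4 := hS.re_inner_nonneg_left u
  rw [inv_mul_le_iff₀ hK]
  nlinarith [mul_le_mul_of_nonneg_left h1 (sq_nonneg ‖R‖)]

/-- If `∑ |⟪x j, w⟫|² = ⟪S w, w⟫` for all `w`, then `S` is the frame operator of `x`. -/
theorem isFrameOperator_of_hasSum {𝕜 H ι : Type*} [RCLike 𝕜] [NormedAddCommGroup H]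
    [InnerProductSpace 𝕜 H] [CompleteSpace H] {S : H →L[𝕜] H} (hS : S.IsPositive) {x : ι → H}
    (h : ∀ w, HasSum (fun j => ‖inner 𝕜 (x j) w‖ ^ 2) (RCLike.re (inner 𝕜 (S w) w))) :
    IsFrameOperator S x := by
  intro w
  -- The remainders are positive with forms bounded by `‖S‖`, so `‖D F w‖² ≤ ‖S‖ ⟪D F w, w⟫`:
  -- convergence of the forms gives convergence in norm.
  let D : Finset ι → H →L[𝕜] H := fun F => S - ∑ j ∈ F, rankOne 𝕜 (x j) (x j)
  have hDapp : ∀ F u, D F u = S u - ∑ j ∈ F, inner 𝕜 (x j) u • x j := by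
    intro F u
    simp [D]
  have hDre : ∀ F u, RCLike.re (inner 𝕜 (D F u) u) =
      RCLike.re (inner 𝕜 (S u) u) - ∑ j ∈ F, ‖inner 𝕜 (x j) u‖ ^ 2 := by
    intro F u
    rw [hDapp, inner_sub_left, map_sub, sum_inner, map_sum]
    congr 1
    refine Finset.sum_congr rfl fun j _ => ?_
    rw [inner_smul_left, RCLike.conj_mul, ← RCLike.ofReal_pow, RCLike.ofReal_re]
  have hDpos : ∀ F, (D F).IsPositive := by
    intro F
    rw [ContinuousLinearMap.isPositive_def']
    refine ⟨hS.isSelfAdjoint.sub ?_, fun u => ?_⟩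
    · exact (ContinuousLinearMap.isPositive_sum F fun j _ =>
        isPositive_rankOne_self (x j)).isSelfAdjoint
    · rw [ContinuousLinearMap.reApplyInnerSelf_apply, hDre, sub_nonneg]
      exact sum_le_hasSum F (fun _ _ => by positivity) (h u)
  have hDle : ∀ F u, RCLike.re (inner 𝕜 (D F u) u) ≤ ‖S‖ * ‖u‖ ^ 2 := by
    intro F u
    rw [hDre]
    have : 0 ≤ ∑ j ∈ F, ‖inner 𝕜 (x j) u‖ ^ 2 := by positivity
    linarith [S.re_inner_apply_self_le u]
  have hlim : Tendsto (fun F => ‖S‖ * RCLike.re (inner 𝕜 (D F w) w)) atTop (𝓝 0) := by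
    have h1 : Tendsto (fun F => ‖S‖ * (RCLike.re (inner 𝕜 (S w) w) -
        ∑ j ∈ F, ‖inner 𝕜 (x j) w‖ ^ 2)) atTop (𝓝 (‖S‖ * (RCLike.re (inner 𝕜 (S w) w) -
        RCLike.re (inner 𝕜 (S w) w)))) :=
      (tendsto_const_nhds.sub (h w)).const_mul _
    simpa only [hDre, sub_self, mul_zero] using h1
  have hsq : Tendsto (fun F => ‖D F w‖ ^ 2) atTop (𝓝 0) :=
    squeeze_zero (fun _ => by positivity) (fun F => (hDpos F).norm_sq_apply_le (hDle F) w) hlim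
  have hn : Tendsto (fun F => ‖D F w‖) atTop (𝓝 0) := by
    have := (Real.continuous_sqrt.tendsto 0).comp hsq
    simpa [Function.comp_def, Real.sqrt_sq] using this
  have hd := tendsto_zero_iff_norm_tendsto_zero.mpr hn
  have h2 := (tendsto_const_nhds (x := S w)).sub hd
  rw [sub_zero] at h2
  refine h2.congr fun F => ?_
  rw [hDapp, sub_sub_cancel]

theorem isFrame_of_hasSum {𝕜 H ι : Type*} [RCLike 𝕜] [NormedAddCommGroup H]
    [InnerProductSpace 𝕜 H] [CompleteSpace H] {S : H →L[𝕜] H} {c : ℝ} (hc : 0 < c)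
    (hS : ∀ u, c * ‖u‖ ^ 2 ≤ RCLike.re (inner 𝕜 (S u) u)) {x : ι → H}
    (h : ∀ w, HasSum (fun j => ‖inner 𝕜 (x j) w‖ ^ 2) (RCLike.re (inner 𝕜 (S w) w))) :
    IsFrame 𝕜 x := by
  refine ⟨?_, c, max c ‖S‖, hc, le_max_left _ _, fun w => ⟨(h w).summable, ?_, ?_⟩⟩
  · rw [Submodule.topologicalClosure_eq_top_iff, Submodule.eq_bot_iff]
    intro w hw
    have hz : ∀ j, inner 𝕜 (x j) w = 0 := fun j =>
      (Submodule.mem_orthogonal _ _).mp hw _ (Submodule.subset_span ⟨j, rfl⟩)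
    have h0 : RCLike.re (inner 𝕜 (S w) w) = 0 := by
      refine (h w).unique ?_
      simp [hz]
    have h1 := hS w
    rw [h0] at h1
    by_contra hne
    have : 0 < ‖w‖ := norm_pos_iff.mpr hne
    have : 0 < c * ‖w‖ ^ 2 := by positivity
    linarith
  · rw [(h w).tsum_eq]; exact hS w
  · rw [(h w).tsum_eq]
    exact (S.re_inner_apply_self_le w).trans (by gcongr; exact le_max_right _ _)

/-! ### Rotations and averaging of norms. -/

theorem norm_sq_rotation {𝕜 H : Type*} [RCLike 𝕜] [NormedAddCommGroup H] [InnerProductSpace 𝕜 H]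
    {c s : ℝ} (hcs : c ^ 2 + s ^ 2 = 1) (x y : H) :
    ‖(c : 𝕜) • x + (s : 𝕜) • y‖ ^ 2 + ‖(c : 𝕜) • y - (s : 𝕜) • x‖ ^ 2 = ‖x‖ ^ 2 + ‖y‖ ^ 2 := by
  rw [@norm_add_sq 𝕜, @norm_sub_sq 𝕜]
  simp only [inner_smul_left, inner_smul_right, norm_smul, RCLike.conj_ofReal, mul_pow,
    RCLike.norm_ofReal, sq_abs, RCLike.re_ofReal_mul]
  rw [inner_re_symm y x]
  linear_combination (‖x‖ ^ 2 + ‖y‖ ^ 2) * hcs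

/-- If `‖x‖² ≤ t ≤ ‖y‖²`, a rotation of the pair `(x, y)` gives its first vector square norm `t`. -/
theorem exists_rotation {𝕜 H : Type*} [RCLike 𝕜] [NormedAddCommGroup H] [InnerProductSpace 𝕜 H]
    {t : ℝ} {x y : H} (hx : ‖x‖ ^ 2 ≤ t) (hy : t ≤ ‖y‖ ^ 2) :
    ∃ x' y' : H, ‖x'‖ ^ 2 = t ∧ ‖x'‖ ^ 2 + ‖y'‖ ^ 2 = ‖x‖ ^ 2 + ‖y‖ ^ 2 ∧
      ∀ w, ‖inner 𝕜 x' w‖ ^ 2 + ‖inner 𝕜 y' w‖ ^ 2 =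
        ‖inner 𝕜 x w‖ ^ 2 + ‖inner 𝕜 y w‖ ^ 2 := by
  have hcont : Continuous fun θ : ℝ =>
      ‖((Real.cos θ : ℝ) : 𝕜) • x + ((Real.sin θ : ℝ) : 𝕜) • y‖ ^ 2 := by
    have h1 : Continuous fun θ : ℝ => ((Real.cos θ : ℝ) : 𝕜) :=
      RCLike.continuous_ofReal.comp Real.continuous_cos
    have h2 : Continuous fun θ : ℝ => ((Real.sin θ : ℝ) : 𝕜) :=
      RCLike.continuous_ofReal.comp Real.continuous_sin
    fun_prop
  have hivt := intermediate_value_Icc (a := 0) (b := Real.pi / 2) (by positivity) hcont.continuousOn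
  obtain ⟨θ, -, hθ⟩ := hivt (show t ∈ _ by simpa using ⟨hx, hy⟩)
  have hcs := Real.cos_sq_add_sin_sq θ
  refine ⟨((Real.cos θ : ℝ) : 𝕜) • x + ((Real.sin θ : ℝ) : 𝕜) • y,
    ((Real.cos θ : ℝ) : 𝕜) • y - ((Real.sin θ : ℝ) : 𝕜) • x, hθ, norm_sq_rotation hcs x y,
    fun w => ?_⟩
  -- The same identity in the space `𝕜`: the coefficients are real, so conjugation does not affect
  -- them.
  have := norm_sq_rotation (𝕜 := 𝕜) hcs (inner 𝕜 x w) (inner 𝕜 y w)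
  rw [← this]
  simp only [inner_add_left, inner_sub_left, inner_smul_left, RCLike.conj_ofReal, smul_eq_mul]

theorem Fintype.sum_update_update {ι α : Type*} [Fintype ι] [DecidableEq ι] (x : ι → α) {i j : ι}
    (hij : i ≠ j) {a b : α} (f : α → ℝ) (h : f a + f b = f (x i) + f (x j)) :
    ∑ k, f (Function.update (Function.update x i a) j b k) = ∑ k, f (x k) := by
  rw [← Finset.sum_compl_add_sum {i, j}, ← Finset.sum_compl_add_sum {i, j} fun k => f (x k),
    Finset.sum_pair hij, Finset.sum_pair hij]
  congr 1
  · refine Finset.sum_congr rfl fun k hk => ?_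
    simp only [Finset.compl_insert, Finset.mem_erase, Finset.mem_compl, Finset.mem_singleton,
      ne_eq] at hk
    rw [Function.update_of_ne hk.2, Function.update_of_ne hk.1]
  · simpa [Function.update_of_ne hij] using h

/-- A finite family whose square norms have average `t` can be replaced by a family of the same
length, with the same frame operator and all square norms equal to `t`. -/
theorem exists_equal_norm_of_average (𝕜 : Type*) {H ι : Type*} [RCLike 𝕜] [NormedAddCommGroup H]
    [InnerProductSpace 𝕜 H] [Fintype ι] {t : ℝ} (x : ι → H)
    (hx : ∑ i, ‖x i‖ ^ 2 = Fintype.card ι * t) :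
    ∃ y : ι → H, (∀ i, ‖y i‖ ^ 2 = t) ∧
      ∀ w, ∑ i, ‖inner 𝕜 (y i) w‖ ^ 2 = ∑ i, ‖inner 𝕜 (x i) w‖ ^ 2 := by
  classical
  induction hn : (Finset.univ.filter fun i => ‖x i‖ ^ 2 ≠ t).card using Nat.strong_induction_on
    generalizing x with
  | _ n ih =>
    by_cases hall : ∀ i, ‖x i‖ ^ 2 = t
    · exact ⟨x, hall, fun _ => rfl⟩
    have hsum : ∑ i, ‖x i‖ ^ 2 = ∑ _i : ι, t := by
      rw [hx, Finset.sum_const, nsmul_eq_mul, Finset.card_univ]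
    have hi : ∃ i, ‖x i‖ ^ 2 < t := by
      by_contra! h
      exact hall fun i => ((Finset.sum_eq_sum_iff_of_le fun i _ => h i).mp hsum.symm i
        (Finset.mem_univ i)).symm
    have hj : ∃ j, t < ‖x j‖ ^ 2 := by
      by_contra! h
      exact hall fun i => (Finset.sum_eq_sum_iff_of_le fun i _ => h i).mp hsum i
        (Finset.mem_univ i)
    obtain ⟨i, hi⟩ := hi
    obtain ⟨j, hj⟩ := hj
    have hij : i ≠ j := by
      rintro rfl
      exact lt_asymm hi hj
    obtain ⟨a, b, ha, hab, hw⟩ := exists_rotation (𝕜 := 𝕜) hi.le hj.le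
    -- Index `i` becomes correct and `j` was already wrong, so the number of wrong norms drops.
    have hlt : (Finset.univ.filter fun k =>
        ‖Function.update (Function.update x i a) j b k‖ ^ 2 ≠ t).card < n := by
      rw [← hn]
      refine Finset.card_lt_card (Finset.ssubset_iff_subset_ne.mpr ⟨fun k hk => ?_, fun heq => ?_⟩)
      · simp only [Finset.mem_filter, Finset.mem_univ, true_and] at hk ⊢
        by_cases hkj : k = j
        · rw [hkj]; exact hj.ne'
        by_cases hki : k = i
        · rw [hki]; exact hi.ne
        rwa [Function.update_of_ne hkj, Function.update_of_ne hki] at hk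
      · have hmem : i ∈ Finset.univ.filter fun k => ‖x k‖ ^ 2 ≠ t := by simpa using hi.ne
        rw [← heq] at hmem
        simp [Function.update_of_ne hij, ha] at hmem
    obtain ⟨y, hy, hyw⟩ := ih _ hlt (Function.update (Function.update x i a) j b)
      (by rw [← hx]; exact Fintype.sum_update_update x hij (fun v => ‖v‖ ^ 2) hab) rfl
    exact ⟨y, hy, fun w => (hyw w).trans
      (Fintype.sum_update_update x hij (fun v => ‖inner 𝕜 v w‖ ^ 2) (hw w))⟩

/-- Padding with zero vectors, a finite family with total square norm `k t` has the same frame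
operator as a family of any length `k` at least its own with all square norms equal to `t`. -/
theorem exists_equal_norm_fin (𝕜 : Type*) {H ι : Type*} [RCLike 𝕜] [NormedAddCommGroup H]
    [InnerProductSpace 𝕜 H] [Fintype ι] {t : ℝ} {k : ℕ} (hk : Fintype.card ι ≤ k) (x : ι → H)
    (hx : ∑ i, ‖x i‖ ^ 2 = k * t) :
    ∃ y : Fin k → H, (∀ i, ‖y i‖ ^ 2 = t) ∧
      ∀ w, ∑ i, ‖inner 𝕜 (y i) w‖ ^ 2 = ∑ i, ‖inner 𝕜 (x i) w‖ ^ 2 := by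
  obtain ⟨e⟩ : Nonempty (ι ↪ Fin k) :=
    Function.Embedding.nonempty_of_card_le (by simpa using hk)
  have hsum : ∀ f : H → ℝ, f 0 = 0 → ∑ i, f (Function.extend e x 0 i) = ∑ i, f (x i) := by
    intro f hf
    refine (Fintype.sum_of_injective e e.injective _ _ (fun i hi => ?_) fun i => ?_).symm
    · rw [Function.extend_apply' _ _ _ (by simpa using hi)]
      exact hf
    · rw [e.injective.extend_apply]
  obtain ⟨y, hy, hyw⟩ := exists_equal_norm_of_average 𝕜 (Function.extend e x 0) (t := t)
    (by rw [hsum (fun v => ‖v‖ ^ 2) (by simp), hx, Fintype.card_fin])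
  exact ⟨y, hy, fun w => (hyw w).trans (hsum (fun v => ‖inner 𝕜 v w‖ ^ 2) (by simp))⟩

/-! ### Infinite families: blocks with a carry. -/

/-- Grouping: if a sequence of finite blocks of vectors of equal length is such that every block has
total square norm at least `(length + 1) t` and contains a vector of square norm at least `t`,
then there is a sequence of vectors of square norm `t` with the same frame operator. -/
theorem exists_equal_norm_of_blocks (𝕜 : Type*) {H ι : Type*} [RCLike 𝕜] [NormedAddCommGroup H]
    [InnerProductSpace 𝕜 H] [Fintype ι] {t : ℝ} (ht : 0 < t) (i₀ : ι) (G : ℕ → ι → H)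
    (hlast : ∀ n, t ≤ ‖G n i₀‖ ^ 2)
    (htot : ∀ n, (Fintype.card ι + 1) * t ≤ ∑ i, ‖G n i‖ ^ 2) {Q : H → ℝ}
    (hQ : ∀ w, HasSum (fun n => ∑ i, ‖inner 𝕜 (G n i) w‖ ^ 2) (Q w)) :
    ∃ x : ℕ → H, (∀ j, ‖x j‖ ^ 2 = t) ∧ ∀ w, HasSum (fun j => ‖inner 𝕜 (x j) w‖ ^ 2) (Q w) := by
  classical
  -- The total square norm before block `n`, in units of `t`; its fractional part is what must be
  -- carried into block `n`.
  let cum : ℕ → ℝ := fun n => ∑ j ∈ Finset.range n, (∑ i, ‖G j i‖ ^ 2) / t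
  have hcum : ∀ n, cum (n + 1) = cum n + (∑ i, ‖G n i‖ ^ 2) / t := fun n =>
    Finset.sum_range_succ _ _
  let c : ℕ → ℝ := fun n => Int.fract (cum (n + 1)) * t / ‖G n i₀‖ ^ 2
  have hGpos : ∀ n, 0 < ‖G n i₀‖ ^ 2 := fun n => ht.trans_le (hlast n)
  have hc0 : ∀ n, 0 ≤ c n := fun n =>
    div_nonneg (mul_nonneg (Int.fract_nonneg _) ht.le) (hGpos n).le
  have hc1 : ∀ n, c n ≤ 1 := by
    intro n
    rw [div_le_one (hGpos n)]
    nlinarith [Int.fract_lt_one (cum (n + 1)), hlast n]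
  -- `u n` is the carry into block `n`, zero at the start; `d n` is what stays of the split vector,
  -- and `B n` is the adjusted block.
  let u : ℕ → H := fun n => Nat.casesOn n 0 fun m => ((√(c m) : ℝ) : 𝕜) • G m i₀
  let d : ℕ → H := fun n => ((√(1 - c n) : ℝ) : 𝕜) • G n i₀
  let B : ℕ → Option ι → H := fun n o => o.elim (u n) (Function.update (G n) i₀ (d n))
  have hB : ∀ f : H → ℝ, (∀ (r : ℝ) v, 0 ≤ r → f (((√r : ℝ) : 𝕜) • v) = r * f v) → ∀ n,
      ∑ o, f (B n o) = f (u n) + ∑ i, f (G n i) - f (u (n + 1)) := by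
    intro f hf n
    have h1 : f (u (n + 1)) = c n * f (G n i₀) := hf _ _ (hc0 n)
    have h2 : f (d n) = (1 - c n) * f (G n i₀) := hf _ _ (sub_nonneg.mpr (hc1 n))
    have h3 : ∑ i, f (Function.update (G n) i₀ (d n) i) =
        ∑ i, f (G n i) - f (G n i₀) + f (d n) := by
      rw [← Finset.add_sum_erase _ _ (Finset.mem_univ i₀),
        ← Finset.add_sum_erase _ (fun i => f (G n i)) (Finset.mem_univ i₀),
        Finset.sum_congr rfl fun i hi => by
          rw [Function.update_of_ne (Finset.ne_of_mem_erase hi)]]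
      rw [Function.update_self]
      ring
    rw [Fintype.sum_option]
    change f (u n) + ∑ i, f (Function.update (G n) i₀ (d n) i) = _
    rw [h3, h1, h2]
    ring
  have hfnorm : ∀ (r : ℝ) (v : H), 0 ≤ r → ‖((√r : ℝ) : 𝕜) • v‖ ^ 2 = r * ‖v‖ ^ 2 := by
    intro r v hr
    rw [norm_smul, mul_pow, RCLike.norm_ofReal, sq_abs, Real.sq_sqrt hr]
  have hfinner : ∀ (w : H) (r : ℝ) (v : H), 0 ≤ r →
      ‖inner 𝕜 (((√r : ℝ) : 𝕜) • v) w‖ ^ 2 = r * ‖inner 𝕜 v w‖ ^ 2 := by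
    intro w r v hr
    rw [inner_smul_left, RCLike.conj_ofReal, ← smul_eq_mul]
    rw [norm_smul, mul_pow, RCLike.norm_ofReal, sq_abs, Real.sq_sqrt hr]
  have hu : ∀ n, ‖u n‖ ^ 2 = Int.fract (cum n) * t := by
    rintro (_ | n)
    · simp [u, cum]
    · change ‖((√(c n) : ℝ) : 𝕜) • G n i₀‖ ^ 2 = _
      rw [hfnorm _ _ (hc0 n), div_mul_cancel₀ _ (hGpos n).ne']
  -- The carry lengthens a block to `card ι + 1`; the hypothesis on totals ensures that the target
  -- length `k n` is at least that.
  have hfloor : ∀ n, ⌊cum n⌋ + (Fintype.card ι + 1 : ℕ) ≤ ⌊cum (n + 1)⌋ := by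
    intro n
    rw [← Int.floor_add_natCast, hcum]
    refine Int.floor_le_floor ?_
    have := (le_div_iff₀ ht).mpr (htot n)
    push_cast
    linarith
  let k : ℕ → ℕ := fun n => (⌊cum (n + 1)⌋ - ⌊cum n⌋).toNat
  have hk : ∀ n, (k n : ℤ) = ⌊cum (n + 1)⌋ - ⌊cum n⌋ := fun n =>
    Int.toNat_of_nonneg (by have := hfloor n; omega)
  have hcard : ∀ n, Fintype.card (Option ι) ≤ k n := by
    intro n
    rw [Fintype.card_option]
    have := hfloor n
    have := hk n
    omega
  have hBnorm : ∀ n, ∑ o, ‖B n o‖ ^ 2 = k n * t := by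
    intro n
    rw [hB (fun v => ‖v‖ ^ 2) hfnorm n, hu n, hu (n + 1)]
    have h1 : (k n : ℝ) = ⌊cum (n + 1)⌋ - ⌊cum n⌋ := by exact_mod_cast hk n
    have h2 : ∑ i, ‖G n i‖ ^ 2 = (cum (n + 1) - cum n) * t := by
      rw [hcum, add_sub_cancel_left, div_mul_cancel₀ _ ht.ne']
    rw [h1, h2, Int.fract, Int.fract]
    ring
  choose y hy hyw using fun n => exists_equal_norm_fin 𝕜 (hcard n) (B n) (hBnorm n)
  have hpos : ∀ n, 0 < k n := fun n => (Fintype.card_pos (α := Option ι)).trans_le (hcard n)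
  have hsum : ∀ w, HasSum (fun p : Σ n, Fin (k n) => ‖inner 𝕜 (y p.1 p.2) w‖ ^ 2) (Q w) := by
    intro w
    -- The sums over adjusted blocks telescope up to the current carry, whose form is at most that
    -- of the preceding block and so tends to `0`.
    have hz : Tendsto (fun n => ‖inner 𝕜 (u n) w‖ ^ 2) atTop (𝓝 0) := by
      rw [← tendsto_add_atTop_iff_nat 1]
      refine squeeze_zero (fun _ => by positivity) (fun n => ?_)
        (hQ w).summable.tendsto_atTop_zero
      refine (hfinner w _ _ (hc0 n)).le.trans ?_
      refine (mul_le_of_le_one_left (by positivity) (hc1 n)).trans ?_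
      exact Finset.single_le_sum (f := fun i => ‖inner 𝕜 (G n i) w‖ ^ 2)
        (fun _ _ => by positivity) (Finset.mem_univ i₀)
    have hblock : HasSum (fun n => ∑ i, ‖inner 𝕜 (y n i) w‖ ^ 2) (Q w) := by
      rw [hasSum_iff_tendsto_nat_of_nonneg fun _ => by positivity]
      have h1 := (hQ w).tendsto_sum_nat.sub hz
      rw [sub_zero] at h1
      refine h1.congr fun N => ?_
      induction N with
      | zero => simp [u]
      | succ N ih =>
        rw [Finset.sum_range_succ, Finset.sum_range_succ, ← ih, hyw,
          hB (fun v => ‖inner 𝕜 v w‖ ^ 2) (hfinner w) N]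
        ring
    refine HasSum.sigma_of_hasSum hblock (fun n => hasSum_fintype _) ?_
    rw [summable_sigma_of_nonneg fun _ => by positivity]
    refine ⟨fun n => (hasSum_fintype _).summable, ?_⟩
    simpa only [tsum_fintype] using hblock.summable
  have : Infinite (Σ n, Fin (k n)) :=
    Infinite.of_injective (fun n => (⟨n, ⟨0, hpos n⟩⟩ : Σ n, Fin (k n))) fun m n h =>
      (Sigma.mk.inj_iff.mp h).1
  obtain ⟨e⟩ : Nonempty (ℕ ≃ Σ n, Fin (k n)) := by
    obtain ⟨h⟩ := nonempty_denumerable (Σ n, Fin (k n))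
    exact ⟨(Denumerable.eqv _).symm⟩
  exact ⟨fun j => y (e j).1 (e j).2, fun j => hy _ _, fun w => e.hasSum_iff.mpr (hsum w)⟩

/-! ### The factorisation `S = T T†`. -/

/-- A positive bounded-below operator factors as `S = T T†`: take the space with the inner product
`⟪S u, v⟫`, on which `T` acts as `S`. -/
theorem ContinuousLinearMap.IsPositive.exists_inner_equiv {𝕜 : Type*} {H : Type u} [RCLike 𝕜]
    [NormedAddCommGroup H] [InnerProductSpace 𝕜 H] {S : H →L[𝕜] H} (hS : S.IsPositive) {c : ℝ}
    (hc : 0 < c) (hlow : ∀ u, c * ‖u‖ ^ 2 ≤ RCLike.re (inner 𝕜 (S u) u)) :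
    ∃ (E : Type u) (_ : NormedAddCommGroup E) (_ : InnerProductSpace 𝕜 E) (e : H ≃ₗ[𝕜] E),
      ∀ u v, inner 𝕜 (e u) (e v) = inner 𝕜 (S u) v := by
  let core : InnerProductSpace.Core 𝕜 H :=
    { inner := fun u v => inner 𝕜 (S u) v
      conj_inner_symm := fun u v => by
        rw [inner_conj_symm, hS.inner_left_eq_inner_right]
      re_inner_nonneg := fun u => hS.re_inner_nonneg_left u
      add_left := fun u v w => by rw [map_add, inner_add_left]
      smul_left := fun u v r => by rw [map_smul, inner_smul_left]
      definite := fun u hu => by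
        have h1 := hlow u
        rw [hu, map_zero] at h1
        by_contra hne
        have : 0 < ‖u‖ := norm_pos_iff.mpr hne
        have : 0 < c * ‖u‖ ^ 2 := by positivity
        linarith }
  -- The existential hides that `E` is `H`, so the two inner products do not compete on one type.
  exact ⟨H, core.toNormedAddCommGroup, InnerProductSpace.ofCore core.toCore,
    LinearEquiv.refl 𝕜 H, fun _ _ => rfl⟩

/-- Since `⟪e u, e v⟫ = ⟪S u, v⟫`, the map `T = S e⁻¹` has adjoint `e`. The upper and lower bounds
on `S` make `e` bicontinuous, whence `E` is complete. -/
theorem ContinuousLinearMap.IsPositive.exists_eq_comp_adjoint {𝕜 : Type*} {H : Type u} [RCLike 𝕜]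
    [NormedAddCommGroup H] [InnerProductSpace 𝕜 H] [CompleteSpace H] {S : H →L[𝕜] H}
    (hS : S.IsPositive) {c : ℝ} (hc : 0 < c)
    (hlow : ∀ u, c * ‖u‖ ^ 2 ≤ RCLike.re (inner 𝕜 (S u) u)) :
    ∃ (E : Type u) (_ : NormedAddCommGroup E) (_ : InnerProductSpace 𝕜 E) (_ : CompleteSpace E)
      (_ : H ≃L[𝕜] E) (T : E →L[𝕜] H), T ∘L ContinuousLinearMap.adjoint T = S := by
  obtain ⟨E, i1, i2, e, he⟩ := hS.exists_inner_equiv hc hlow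
  have hn : ∀ u, ‖e u‖ ^ 2 = RCLike.re (inner 𝕜 (S u) u) := fun u => by
    rw [← he, inner_self_eq_norm_sq]
  have h1 : ∀ u, ‖e u‖ ≤ √‖S‖ * ‖u‖ := by
    intro u
    refine le_of_sq_le_sq ?_ (by positivity)
    rw [hn, mul_pow, Real.sq_sqrt (norm_nonneg _)]
    exact S.re_inner_apply_self_le u
  have h2 : ∀ v, ‖e.symm v‖ ≤ √c⁻¹ * ‖v‖ := by
    intro v
    refine le_of_sq_le_sq ?_ (by positivity)
    rw [mul_pow, Real.sq_sqrt (by positivity), ← div_eq_inv_mul, le_div_iff₀ hc, mul_comm]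
    simpa [← hn] using hlow (e.symm v)
  let e' : H ≃L[𝕜] E :=
    { e with
      continuous_toFun := (e.toLinearMap.mkContinuous _ h1).continuous
      continuous_invFun := (e.symm.toLinearMap.mkContinuous _ h2).continuous }
  have : CompleteSpace E := (completeSpace_congr (e := e'.toEquiv) e'.isUniformEmbedding).mp ‹_›
  refine ⟨E, i1, i2, this, e', S ∘L (e'.symm : E →L[𝕜] H), ?_⟩
  have hadj : ContinuousLinearMap.adjoint (S ∘L (e'.symm : E →L[𝕜] H)) = (e' : H →L[𝕜] E) := by
    symm
    rw [ContinuousLinearMap.eq_adjoint_iff]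
    intro u v
    have h3 := he u (e.symm v)
    rw [e.apply_symm_apply, hS.inner_left_eq_inner_right] at h3
    exact h3
  rw [hadj]
  ext u
  simp

/-! ### The essential norm and orthonormal sequences. -/

theorem essNorm_le {𝕜 H : Type*} [RCLike 𝕜] [NormedAddCommGroup H] [InnerProductSpace 𝕜 H]
    (B K : H →L[𝕜] H) (hK : IsCompactOperator K) : essNorm B ≤ ‖B - K‖ :=
  csInf_le ⟨0, by rintro _ ⟨_, _, rfl⟩; exact norm_nonneg _⟩ ⟨K, hK, rfl⟩

/-- Units form an open set, so a compact operator close to `S` would be invertible, making the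
identity compact. -/
theorem essNorm_pos {𝕜 H : Type*} [RCLike 𝕜] [NormedAddCommGroup H] [InnerProductSpace 𝕜 H]
    [CompleteSpace H] (hH : ¬ FiniteDimensional 𝕜 H) {S : H →L[𝕜] H} (hS : IsUnit S) :
    0 < essNorm S := by
  obtain ⟨ε, hε, hball⟩ := Metric.isOpen_iff.mp (Units.isOpen (R := H →L[𝕜] H)) S hS
  refine hε.trans_le (le_csInf ⟨_, 0, isCompactOperator_zero, rfl⟩ ?_)
  rintro _ ⟨K, hK, rfl⟩
  by_contra! hlt
  obtain ⟨U, rfl⟩ : IsUnit K := hball (by rwa [mem_ball_iff_norm'])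
  have h := hK.comp_clm (↑U⁻¹ : H →L[𝕜] H)
  have hid : (U : H →L[𝕜] H) ∘ (↑U⁻¹ : H →L[𝕜] H) = id :=
    funext fun u => congrArg (fun A : H →L[𝕜] H => A u) U.mul_inv
  exact hH (FiniteDimensional.of_isCompactOperator_id (hid ▸ h))

/-- Below the essential norm of `T T†`, the quadratic form `‖T e‖²` is large on some unit vector of
every finite-codimensional subspace. -/
theorem exists_unit_orthogonal_of_lt_essNorm {𝕜 E H : Type*} [RCLike 𝕜] [NormedAddCommGroup E]
    [InnerProductSpace 𝕜 E] [CompleteSpace E] [NormedAddCommGroup H] [InnerProductSpace 𝕜 H]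
    [CompleteSpace H] (T : E →L[𝕜] H) {t : ℝ} (ht : 0 ≤ t)
    (hT : t < essNorm (T ∘L ContinuousLinearMap.adjoint T)) (F : Submodule 𝕜 E)
    [FiniteDimensional 𝕜 F] :
    ∃ e : E, ‖e‖ = 1 ∧ t ≤ ‖T e‖ ^ 2 ∧ e ∈ Fᗮ := by
  by_contra! hcon
  have hle : ∀ e ∈ Fᗮ, ‖T e‖ ≤ √t * ‖e‖ := by
    intro e he
    by_cases h0 : e = 0
    · simp [h0]
    have hn : ‖e‖ ≠ 0 := norm_ne_zero_iff.mpr h0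
    have h1 : ‖((‖e‖⁻¹ : ℝ) : 𝕜) • e‖ = 1 := by
      rw [norm_smul, RCLike.norm_ofReal, abs_of_nonneg (by positivity), inv_mul_cancel₀ hn]
    have h2 : ‖T (((‖e‖⁻¹ : ℝ) : 𝕜) • e)‖ ^ 2 ≤ t := by
      by_contra! h
      exact hcon _ h1 h.le (Submodule.smul_mem _ _ he)
    rw [map_smul, norm_smul, RCLike.norm_ofReal, abs_of_nonneg (by positivity), mul_pow, inv_pow,
      inv_mul_le_iff₀ (by positivity)] at h2
    refine le_of_sq_le_sq ?_ (by positivity)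
    rw [mul_pow, Real.sq_sqrt ht]
    linarith
  let P : E →L[𝕜] E := Fᗮ.starProjection
  -- `K` has finite rank and `T T† - K = (T P)(T P)†` has norm at most `‖T P‖² ≤ t`, against the
  -- essential norm.
  let K : H →L[𝕜] H := T ∘L (F.starProjection ∘L ContinuousLinearMap.adjoint T)
  have hK : IsCompactOperator K := by
    have h1 : IsCompactOperator (F.orthogonalProjectionOnto : E →L[𝕜] F) := by
      have : ProperSpace F := FiniteDimensional.proper_rclike 𝕜 F
      exact (isCompactOperator_id (E := F)).comp_clm F.orthogonalProjectionOnto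
    exact ((h1.comp_clm (ContinuousLinearMap.adjoint T)).clm_comp F.subtypeL).clm_comp T
  have hTP : ‖T ∘L P‖ ≤ √t := by
    refine ContinuousLinearMap.opNorm_le_bound _ (Real.sqrt_nonneg _) fun e => ?_
    refine (hle _ (Submodule.starProjection_apply_mem _ e)).trans ?_
    gcongr
    exact Submodule.norm_starProjection_apply_le _ e
  have hSK : T ∘L ContinuousLinearMap.adjoint T - K =
      (T ∘L P) ∘L ContinuousLinearMap.adjoint (T ∘L P) := by
    have hP : ContinuousLinearMap.adjoint P = P :=
      (ContinuousLinearMap.isSelfAdjoint_iff'.mp (isSelfAdjoint_starProjection _))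
    rw [ContinuousLinearMap.adjoint_comp, hP]
    ext u
    have h1 : P (P (ContinuousLinearMap.adjoint T u)) = P (ContinuousLinearMap.adjoint T u) :=
      Submodule.starProjection_eq_self_iff.mpr (Submodule.starProjection_apply_mem _ _)
    have h2 : P (ContinuousLinearMap.adjoint T u) = ContinuousLinearMap.adjoint T u -
        F.starProjection (ContinuousLinearMap.adjoint T u) :=
      Submodule.starProjection_orthogonal_val _
    change T (ContinuousLinearMap.adjoint T u) - T (F.starProjection
      (ContinuousLinearMap.adjoint T u)) = T (P (P (ContinuousLinearMap.adjoint T u)))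
    rw [h1, h2, map_sub]
  have h3 := essNorm_le (T ∘L ContinuousLinearMap.adjoint T) K hK
  rw [hSK] at h3
  have h4 := ContinuousLinearMap.opNorm_comp_le (T ∘L P) (ContinuousLinearMap.adjoint (T ∘L P))
  rw [LinearIsometryEquiv.norm_map] at h4
  nlinarith [Real.mul_self_sqrt ht, norm_nonneg (T ∘L P), Real.sqrt_nonneg t]

/-- Greedy choice: each vector is taken orthogonal to the span of those already chosen. -/
theorem exists_orthonormal_seq_of_lt_essNorm {𝕜 E H : Type*} [RCLike 𝕜] [NormedAddCommGroup E]
    [InnerProductSpace 𝕜 E] [CompleteSpace E] [NormedAddCommGroup H] [InnerProductSpace 𝕜 H]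
    [CompleteSpace H] (T : E →L[𝕜] H) {t : ℝ} (ht : 0 ≤ t)
    (hT : t < essNorm (T ∘L ContinuousLinearMap.adjoint T)) :
    ∃ f : ℕ → E, Orthonormal 𝕜 f ∧ ∀ n, t ≤ ‖T (f n)‖ ^ 2 := by
  have : Std.Symm fun e e' : E => inner 𝕜 e e' = 0 := ⟨fun _ _ h => inner_eq_zero_symm.mp h⟩
  obtain ⟨f, hf, hr⟩ := exists_seq_of_forall_finset_exists'
    (fun e : E => ‖e‖ = 1 ∧ t ≤ ‖T e‖ ^ 2) (fun e e' => inner 𝕜 e e' = 0) fun s _ => by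
      have : FiniteDimensional 𝕜 (Submodule.span 𝕜 (s : Set E)) :=
        FiniteDimensional.span_finset 𝕜 s
      obtain ⟨e, he1, het, heF⟩ := exists_unit_orthogonal_of_lt_essNorm T ht hT
        (Submodule.span 𝕜 (s : Set E))
      exact ⟨e, ⟨he1, het⟩, fun e' he' =>
        (Submodule.mem_orthogonal _ _).mp heF _ (Submodule.subset_span he')⟩
  exact ⟨f, ⟨fun n => (hf n).1, fun m n hmn => hr hmn⟩, fun n => (hf n).2⟩

/-! ### Hilbert bases arranged in blocks. -/

/-- Distinct members are `√2` apart, so the range is discrete in a second countable space. -/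
theorem Orthonormal.countable {𝕜 E ι : Type*} [RCLike 𝕜] [NormedAddCommGroup E]
    [InnerProductSpace 𝕜 E] [TopologicalSpace.SeparableSpace E] {v : ι → E}
    (hv : Orthonormal 𝕜 v) : Countable ι := by
  have : SecondCountableTopology E := UniformSpace.secondCountable_of_separable E
  have hdist : Pairwise fun a b : Set.range v => 1 ≤ dist a b := by
    intro a b hab
    have h := hv.toSubtypeRange
    have h1 : ‖(a : E) - b‖ ^ 2 = 2 := by
      rw [@norm_sub_sq 𝕜, h.2 hab, h.1 a, h.1 b, map_zero]
      norm_num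
    change 1 ≤ dist (a : E) b
    rw [dist_eq_norm]
    nlinarith [norm_nonneg ((a : E) - b)]
  have : DiscreteTopology (Set.range v) := DiscreteTopology.of_forall_le_dist one_pos hdist
  have : Countable (Set.range v) :=
    TopologicalSpace.separableSpace_iff_countable.mp inferInstance
  exact (Set.rangeFactorization_injective.mpr hv.linearIndependent.injective).countable

theorem HilbertBasis.hasSum_norm_inner_sq {𝕜 E ι : Type*} [RCLike 𝕜] [NormedAddCommGroup E]
    [InnerProductSpace 𝕜 E] (b : HilbertBasis ι 𝕜 E) (v : E) :
    HasSum (fun i => ‖inner 𝕜 (b i) v‖ ^ 2) (‖v‖ ^ 2) := by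
  have h := RCLike.hasSum_re _ (b.hasSum_inner_mul_inner v v)
  rw [inner_self_eq_norm_sq] at h
  refine h.congr_fun fun i => ?_
  rw [← inner_conj_symm v (b i), RCLike.conj_mul, ← RCLike.ofReal_pow, RCLike.ofReal_re]

/-- A countable set containing the values of an injective sequence `φ` injects into
`ℕ × Option (Fin M)`, with `φ` enumerating the pairs whose second component is not `none`. -/
theorem exists_injective_prod_option {W : Type*} [Countable W] {φ : ℕ → W}
    (hφ : Function.Injective φ) (M : ℕ) [NeZero M] :
    ∃ ψ : W → ℕ × Option (Fin M), Function.Injective ψ ∧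
      ∀ n i, ∃ m, ψ (φ m) = (n, some i) := by
  classical
  obtain ⟨enc, henc⟩ := exists_injective_nat W
  let e := Nat.divModEquiv M
  let ψ : W → ℕ × Option (Fin M) := fun w =>
    if h : ∃ n, φ n = w then ((e h.choose).1, some (e h.choose).2) else (enc w, none)
  have hψ : ∀ n, ψ (φ n) = ((e n).1, some (e n).2) := by
    intro n
    have h : ∃ m, φ m = φ n := ⟨n, rfl⟩
    have h1 : h.choose = n := hφ h.choose_spec
    simp only [ψ, dif_pos h, h1]
  have hψ' : ∀ w, (¬ ∃ n, φ n = w) → ψ w = (enc w, none) := fun w h => dif_neg h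
  refine ⟨ψ, fun a b hab => ?_, fun n i => ⟨e.symm (n, i), by simp [hψ]⟩⟩
  by_cases ha : ∃ n, φ n = a <;> by_cases hb : ∃ n, φ n = b
  · obtain ⟨m, rfl⟩ := ha
    obtain ⟨n, rfl⟩ := hb
    rw [hψ, hψ, Prod.mk.injEq, Option.some.injEq] at hab
    rw [e.injective (Prod.ext hab.1 hab.2)]
  · obtain ⟨m, rfl⟩ := ha
    rw [hψ, hψ' b hb] at hab
    simp at hab
  · obtain ⟨n, rfl⟩ := hb
    rw [hψ, hψ' a ha] at hab
    simp at hab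
  · rw [hψ' a ha, hψ' b hb, Prod.mk.injEq] at hab
    exact henc hab.1

/-- Below the essential norm of `T T†`, this operator is the frame operator of a sequence of vectors
of constant square norm `t`. -/
theorem exists_seq_norm_sq_eq_of_lt_essNorm {𝕜 E H : Type*} [RCLike 𝕜] [NormedAddCommGroup E]
    [InnerProductSpace 𝕜 E] [CompleteSpace E] [TopologicalSpace.SeparableSpace E]
    [NormedAddCommGroup H] [InnerProductSpace 𝕜 H] [CompleteSpace H] (T : E →L[𝕜] H) {t : ℝ}
    (ht : 0 < t) (hT : t < essNorm (T ∘L ContinuousLinearMap.adjoint T)) :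
    ∃ x : ℕ → H, (∀ j, ‖x j‖ ^ 2 = t) ∧
      ∀ w, HasSum (fun j => ‖inner 𝕜 (x j) w‖ ^ 2) (‖ContinuousLinearMap.adjoint T w‖ ^ 2) := by
  obtain ⟨s, hts, hs⟩ := exists_between hT
  -- Blocks have `M + 1` entries, `M` of them of square norm at least `s`; this choice gives `M s >
  -- (M + 2) t`, as the grouping lemma requires.
  obtain ⟨M, hM⟩ := exists_nat_gt (2 * t / (s - t))
  have hst : 0 < s - t := sub_pos.mpr hts
  have hM0 : 0 < M := by
    have : (0 : ℝ) < M := lt_trans (by positivity) hM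
    exact_mod_cast this
  rw [div_lt_iff₀ hst] at hM
  have : NeZero M := ⟨hM0.ne'⟩
  obtain ⟨f, hf, hfs⟩ := exists_orthonormal_seq_of_lt_essNorm T (ht.trans hts).le hs
  obtain ⟨W, b, hfW, hb⟩ := hf.toSubtypeRange.exists_hilbertBasis_extension
  have : Countable W := b.orthonormal.countable
  let φ : ℕ → W := fun n => ⟨f n, hfW ⟨n, rfl⟩⟩
  have hφ : Function.Injective φ := fun m n h =>
    hf.linearIndependent.injective (congrArg Subtype.val h)
  obtain ⟨ψ, hψ, hψφ⟩ := exists_injective_prod_option hφ M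
  -- Only `none` slots can remain unfilled; they hold zero vectors.
  let G : ℕ × Option (Fin M) → H := Function.extend ψ (fun w => T (b w)) 0
  have hGψ : ∀ w, G (ψ w) = T (b w) := fun w => hψ.extend_apply _ _ w
  have hGs : ∀ n i, s ≤ ‖G (n, some i)‖ ^ 2 := by
    intro n i
    obtain ⟨m, hm⟩ := hψφ n i
    rw [← hm, hGψ, hb]
    exact hfs m
  have hQ : ∀ w, HasSum (fun p => ‖inner 𝕜 (G p) w‖ ^ 2)
      (‖ContinuousLinearMap.adjoint T w‖ ^ 2) := by
    intro w
    rw [← hψ.hasSum_iff fun p hp => by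
      simp only [G, Function.extend_apply' _ _ _ hp, Pi.zero_apply, inner_zero_left, norm_zero,
        ne_eq, OfNat.ofNat_ne_zero, not_false_eq_true, zero_pow]]
    refine (b.hasSum_norm_inner_sq (ContinuousLinearMap.adjoint T w)).congr_fun fun i => ?_
    rw [Function.comp_apply, hGψ, ContinuousLinearMap.adjoint_inner_right]
  refine exists_equal_norm_of_blocks 𝕜 ht (some (⟨0, hM0⟩ : Fin M)) (fun n o => G (n, o))
    (fun n => hts.le.trans (hGs n _)) (fun n => ?_)
    (fun w => (hQ w).prod_fiberwise fun n => hasSum_fintype _)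
  rw [Fintype.sum_option, Fintype.card_option, Fintype.card_fin]
  have h1 : M * s ≤ ∑ i : Fin M, ‖G (n, some i)‖ ^ 2 := by
    simpa using Finset.card_nsmul_le_sum (Finset.univ : Finset (Fin M))
      (fun i => ‖G (n, some i)‖ ^ 2) s fun i _ => hGs n i
  push_cast
  nlinarith [sq_nonneg ‖G (n, none)‖]

/-! ### Trace and finite dimension. -/

theorem LinearMap.re_trace_eq_sum_norm_sq_of_isFrameOperator {𝕜 H ι : Type*} [RCLike 𝕜]
    [NormedAddCommGroup H] [InnerProductSpace 𝕜 H] [FiniteDimensional 𝕜 H] [Fintype ι]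
    {S : H →L[𝕜] H} {x : ι → H} (h : IsFrameOperator S x) :
    RCLike.re (LinearMap.trace 𝕜 H S.toLinearMap) = ∑ i, ‖x i‖ ^ 2 := by
  have hS : S.toLinearMap = ∑ i, (rankOne 𝕜 (x i) (x i)).toLinearMap := by
    ext w
    rw [ContinuousLinearMap.coe_coe, ← (h w).tsum_eq, tsum_fintype]
    simp
  rw [hS, map_sum, map_sum]
  refine Finset.sum_congr rfl fun i _ => ?_
  rw [trace_rankOne, inner_self_eq_norm_sq]

/-- In finite dimension `n`, an operator `T T†` has families of every length `k ≥ n` of vectors with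
equal norms. -/
theorem exists_fin_norm_sq_eq {𝕜 E H : Type*} [RCLike 𝕜] [NormedAddCommGroup E]
    [InnerProductSpace 𝕜 E] [FiniteDimensional 𝕜 E] [CompleteSpace E] [NormedAddCommGroup H]
    [InnerProductSpace 𝕜 H] [CompleteSpace H] (T : E →L[𝕜] H) {k : ℕ} (hk0 : k ≠ 0)
    (hk : Module.finrank 𝕜 E ≤ k) :
    ∃ (t : ℝ) (x : Fin k → H), (∀ j, ‖x j‖ ^ 2 = t) ∧
      ∀ w, ∑ j, ‖inner 𝕜 (x j) w‖ ^ 2 = ‖ContinuousLinearMap.adjoint T w‖ ^ 2 := by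
  let b := stdOrthonormalBasis 𝕜 E
  obtain ⟨x, hx, hxw⟩ := exists_equal_norm_fin 𝕜 (k := k)
    (t := (∑ i, ‖T (b i)‖ ^ 2) / k) (by simpa using hk) (fun i => T (b i))
    (by field_simp)
  refine ⟨_, x, hx, fun w => ?_⟩
  rw [hxw, ← b.sum_sq_norm_inner_right]
  simp only [ContinuousLinearMap.adjoint_inner_right]

end

/-! ### The main theorem. -/

theorem corollary14 {𝕜 H : Type*} [RCLike 𝕜] [NormedAddCommGroup H] [InnerProductSpace 𝕜 H]
    [CompleteSpace H] [TopologicalSpace.SeparableSpace H]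
    (S : H →L[𝕜] H) (hpos : S.IsPositive) (hinv : IsUnit S) :
    -- `S` is the frame operator of a spherical frame
    (∃ (ι : Type) (_ : Countable ι) (r : ℝ) (x : ι → H),
      IsSphericalFrame 𝕜 r x ∧ IsFrameOperator S x) ∧
    -- finite dimension `n`: every length `k ≥ n` occurs, and the radius is `√(trace S / k)`
    (FiniteDimensional 𝕜 H → ∀ n k : ℕ, Module.finrank 𝕜 H = n → 1 ≤ n → n ≤ k →
      (∃ x : Fin k → H,
        IsSphericalFrame 𝕜 (√(RCLike.re (LinearMap.trace 𝕜 H S.toLinearMap) / k)) x ∧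
          IsFrameOperator S x) ∧
      ∀ (r : ℝ) (x : Fin k → H), IsSphericalFrame 𝕜 r x → IsFrameOperator S x →
        r = √(RCLike.re (LinearMap.trace 𝕜 H S.toLinearMap) / k)) ∧
    -- infinite dimension: every positive radius below the square root of the essential norm occurs
    (¬ FiniteDimensional 𝕜 H → ∀ r : ℝ, 0 < r → r < √(essNorm S) →
      ∃ x : ℕ → H, IsSphericalFrame 𝕜 r x ∧ IsFrameOperator S x) := by
  obtain ⟨c, hc, hlow⟩ := hpos.exists_lower_bound hinv
  obtain ⟨E, _, _, _, e, T, hT⟩ := hpos.exists_eq_comp_adjoint hc hlow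
  have hquad : ∀ w, ‖ContinuousLinearMap.adjoint T w‖ ^ 2 = RCLike.re (inner 𝕜 (S w) w) := by
    intro w
    rw [← hT, ContinuousLinearMap.comp_apply, ← ContinuousLinearMap.adjoint_inner_right,
      inner_self_eq_norm_sq]
  have hfin : FiniteDimensional 𝕜 H → ∀ n k : ℕ, Module.finrank 𝕜 H = n → 1 ≤ n → n ≤ k →
      ∃ x : Fin k → H,
        IsSphericalFrame 𝕜 (√(RCLike.re (LinearMap.trace 𝕜 H S.toLinearMap) / k)) x ∧
          IsFrameOperator S x := by
    intro hH n k hn hn1 hnk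
    have hk0 : k ≠ 0 := by omega
    have hE : FiniteDimensional 𝕜 E := e.toLinearEquiv.finiteDimensional
    obtain ⟨t, x, hx, hxw⟩ := exists_fin_norm_sq_eq T hk0
      (by rw [← e.toLinearEquiv.finrank_eq, hn]; exact hnk)
    have hsum : ∀ w, HasSum (fun j => ‖inner 𝕜 (x j) w‖ ^ 2) (RCLike.re (inner 𝕜 (S w) w)) :=
      fun w => hquad w ▸ hxw w ▸ hasSum_fintype _
    have hop := isFrameOperator_of_hasSum hpos hsum
    have htr : RCLike.re (LinearMap.trace 𝕜 H S.toLinearMap) / k = t := by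
      rw [LinearMap.re_trace_eq_sum_norm_sq_of_isFrameOperator hop]
      simp only [hx, Finset.sum_const, Finset.card_univ, Fintype.card_fin, nsmul_eq_mul]
      field_simp
    -- If `t = 0`, all vectors vanish, contradicting the lower bound of `S` on a nonzero space.
    have ht : 0 < t := by
      have ht0 : 0 ≤ t := hx ⟨0, by omega⟩ ▸ sq_nonneg _
      refine ht0.lt_of_ne' fun h0 => ?_
      have : Nontrivial H := Module.nontrivial_of_finrank_pos (R := 𝕜) (by omega)
      obtain ⟨w, hw⟩ := exists_ne (0 : H)
      have hx0 : ∀ j, x j = 0 := fun j => by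
        have := hx j
        rw [h0] at this
        simpa using this
      have h1 := hlow w
      rw [← hquad, ← hxw] at h1
      simp only [hx0, inner_zero_left, norm_zero, ne_eq, OfNat.ofNat_ne_zero, not_false_eq_true,
        zero_pow, Finset.sum_const_zero] at h1
      have : 0 < ‖w‖ := norm_pos_iff.mpr hw
      have : 0 < c * ‖w‖ ^ 2 := by positivity
      linarith
    rw [htr]
    refine ⟨x, ⟨Real.sqrt_pos.mpr ht, isFrame_of_hasSum hc hlow hsum, fun j => ?_⟩, hop⟩
    rw [mem_sphere_zero_iff_norm, ← hx j, Real.sqrt_sq (norm_nonneg _)]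
  have hinf : ¬ FiniteDimensional 𝕜 H → ∀ r : ℝ, 0 < r → r < √(essNorm S) →
      ∃ x : ℕ → H, IsSphericalFrame 𝕜 r x ∧ IsFrameOperator S x := by
    intro _ r hr hrS
    have : TopologicalSpace.SeparableSpace E :=
      e.surjective.denseRange.separableSpace e.continuous
    obtain ⟨x, hx, hxw⟩ := exists_seq_norm_sq_eq_of_lt_essNorm T (pow_pos hr 2)
      (by rw [hT]; exact (Real.lt_sqrt hr.le).mp hrS)
    have hsum : ∀ w, HasSum (fun j => ‖inner 𝕜 (x j) w‖ ^ 2) (RCLike.re (inner 𝕜 (S w) w)) :=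
      fun w => hquad w ▸ hxw w
    refine ⟨x, ⟨hr, isFrame_of_hasSum hc hlow hsum, fun j => ?_⟩,
      isFrameOperator_of_hasSum hpos hsum⟩
    rw [mem_sphere_zero_iff_norm]
    exact (pow_left_inj₀ (norm_nonneg _) hr.le two_ne_zero).mp (hx j)
  refine ⟨?_, fun hH n k hn hn1 hnk => ⟨hfin hH n k hn hn1 hnk, fun r x hx hop => ?_⟩, hinf⟩
  · by_cases hH : FiniteDimensional 𝕜 H
    · rcases Nat.eq_zero_or_pos (Module.finrank 𝕜 H) with h0 | h0
      · have : Subsingleton H := Module.finrank_zero_iff.mp h0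
        have hsum : ∀ w, HasSum (fun j : Empty => ‖inner 𝕜 (j.elim : H) w‖ ^ 2)
            (RCLike.re (inner 𝕜 (S w) w)) := fun w => by
          rw [Subsingleton.elim (S w) 0, inner_zero_left, map_zero]
          exact hasSum_empty
        -- In dimension zero the empty family works; the radius `1` is arbitrary.
        exact ⟨Empty, inferInstance, 1, fun j => j.elim,
          ⟨one_pos, isFrame_of_hasSum hc hlow hsum, fun j => j.elim⟩,
          isFrameOperator_of_hasSum hpos hsum⟩
      · obtain ⟨x, hx⟩ := hfin hH _ _ rfl h0 le_rfl
        exact ⟨_, inferInstance, _, x, hx⟩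
    · have h0 := Real.sqrt_pos.mpr (essNorm_pos hH hinv)
      obtain ⟨x, hx⟩ := hinf hH _ (half_pos h0) (half_lt_self h0)
      exact ⟨_, inferInstance, _, x, hx⟩
  · have hk0 : k ≠ 0 := by omega
    rw [LinearMap.re_trace_eq_sum_norm_sq_of_isFrameOperator hop]
    have hn : ∀ j, ‖x j‖ = r := fun j => mem_sphere_zero_iff_norm.mp (hx.2.2 j)
    simp only [hn, Finset.sum_const, Finset.card_univ, Fintype.card_fin, nsmul_eq_mul]
    rw [mul_div_cancel_left₀ _ (Nat.cast_ne_zero.mpr hk0), Real.sqrt_sq hx.1.le]
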